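/- **Theorem 4.4.** Every free amalgamation theory is $\mathrm{NSOP}_4$. Here the terms are as follows. Let $T$ be a complete first-order theory in a language $\mathcal L$, and let $\mathbb M$ be a monster model of $T$: a $\kappa$-saturated, strongly $\kappa$-homogeneous model, where $\kappa>|\mathcal L|+\aleph_0$. A subset of $\mathbb M$ is *small* if it has cardinality less than $\kappa$. Below, $A,B,C,D$ and $A_0,B_0$ range over small subsets of $\mathbb M$, tuples are of length less than $\kappa$ and are identified with their ranges where sets are expected, and $AB=A\cup B$. A set $A$ is *closed* if $\operatorname{acl}(A)=A$, where $\operatorname{acl}$ is model-theoretic algebraic closure in $\mathbb M$. For tuples $a,b$ with the same index set, $a\equiv_C b$ means that $\sigma(a)=b$ for some $\sigma\in\operatorname{Aut}(\mathbb M/C)$. $T$ is a *free amalgamation theory* if there is a ternary relation $A\perp_C B$ on small subsets of $\mathbb M$ with the following properties. 1. (invariance) If $A\perp_C B$ and $\sigma\in\operatorname{Aut}(\mathbb M)$ then $\sigma(A)\perp_{\sigma(C)}\sigma(B)$. 2. (monotonicity) If $A\perp_C B$, $A_0\subseteq A$ and $B_0\subseteq B$, then $A_0\perp_C B_0$. 3.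 (symmetry) If $A\perp_C B$ then $B\perp_C A$. 4. (full transitivity) If $D\subseteq C\subseteq B$, then $A\perp_D B$ if and only if $A\perp_C B$ and $A\perp_D C$. 5. (full existence) For all $B$, all closed $C$ and all tuples $a$, there is $a'\equiv_C a$ such that $a'\perp_C B$. 6. (stationarity) For all closed $C$ and closed tuples $a,a',b$ with $C\subseteq a\cap b$, if $a\perp_C b$, $a'\perp_C b$ and $a'\equiv_C a$, then $ab\equiv_C a'b$. 7. (freedom) If $A\perp_C B$ and $C\cap AB\subseteq D\subseteq C$, then $A\perp_D B$. 8. (closure) For all closed $A,B,C$, if $C\subseteq A\cap B$ and $A\perp_C B$, then $AB$ is closed. $T$ is $\mathrm{NSOP}_4$ if for every indiscernible sequence $(a_i)_{i<\omega}$ of tuples in $\mathbb M$, if $p(x,y)=\operatorname{tp}(a_0,a_1)$, then $$p(x_1,x_2)\cup p(x_2,x_3)\cup p(x_3,x_4)\cup p(x_4,x_1)$$ is consistent. -/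

import Mathlib

universe u v w

namespace FreeAmalgamation

open FirstOrder FirstOrder.Language

section Basics

variable (L : FirstOrder.Language.{u, v}) {M : Type w} [L.Structure M]

/-- The (model-theoretic) algebraic closure of `A` in `M`: the union of all finite subsets of `M`
that are definable by a first-order formula with parameters from `A`. -/
def acl (A : Set M) : Set M :=
  {x | ∃ S : Set M, A.Definable₁ L S ∧ S.Finite ∧ x ∈ S}

/-- `A` is closed if it equals its algebraic closure. -/
def IsClosedSet (A : Set M) : Prop :=
  acl L A = A

/-- `a ≡_C b` for tuples `a, b` with the same domain `I`: some automorphism of `M` fixing `C`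
pointwise maps `a` to `b`. -/
def EquivOver (C : Set M) {I : Type w} (a b : I → M) : Prop :=
  ∃ σ : M ≃[L] M, (∀ c ∈ C, σ c = c) ∧ ∀ i, σ (a i) = b i

/-- The complete type over the empty set of a tuple `a`, in variables indexed by `I`. -/
def tp {I : Type w} (a : I → M) : Set (L.Formula I) :=
  {φ | φ.Realize a}

/-- A sequence of tuples (each with domain `I`) is indiscernible over the empty set: any two
finite strictly increasing subsequences of the same length have the same type. -/
def Indiscernible {I : Type w} (a : ℕ → I → M) : Prop :=
  ∀ (n : ℕ) (s t : Fin n → ℕ), StrictMono s → StrictMono t → ∀ φ : L.Formula (Fin n × I),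
    φ.Realize (fun k => a (s k.1) k.2) ↔ φ.Realize (fun k => a (t k.1) k.2)

end Basics

section Types

variable {L : FirstOrder.Language.{u, v}}

/-- A set of formulas in the variables indexed by `J` is consistent if it is satisfied by some
assignment in some structure, that is, if it becomes a satisfiable theory when the variables are
replaced by new constants. -/
def Consistent {J : Type w} (Γ : Set (L.Formula J)) : Prop :=
  Theory.IsSatisfiable (T := (Formula.equivSentence '' Γ : L[[J]].Theory))

/-- For a set `p` of formulas in two tuples of variables `x, y` (both with domain `I`), the set
`p(x_1, x_2) ∪ ... ∪ p(x_{n-1}, x_n) ∪ p(x_n, x_1)` of formulas in `n` tuples of variables.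
Here `finRotate n` is the cyclic successor on `Fin n`. -/
def cycle {I : Type w} (p : Set (L.Formula (I ⊕ I))) (n : ℕ) : Set (L.Formula (Fin n × I)) :=
  ⋃ k : Fin n,
    Formula.relabel (Sum.elim (fun i => (k, i)) (fun i => (finRotate n k, i))) '' p

end Types

section Monster

variable {L : FirstOrder.Language.{u, v}}

/-- `M` is `κ`-saturated: every set of formulas in one variable, with parameters from a subset of
cardinality less than `κ`, that is finitely satisfiable in `M` is realized in `M`. -/
def IsSaturated (L : FirstOrder.Language.{u, v}) (κ : Cardinal.{w}) (M : Type w) [L.Structure M] : Prop :=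
  ∀ A : Set M, Cardinal.mk A < κ → ∀ Γ : Set (L[[A]].Formula Unit),
    (∀ Γ₀ : Set (L[[A]].Formula Unit), Γ₀ ⊆ Γ → Γ₀.Finite →
      ∃ x : M, ∀ φ ∈ Γ₀, φ.Realize (fun _ => x)) →
    ∃ x : M, ∀ φ ∈ Γ, φ.Realize (fun _ => x)

/-- `M` is strongly `κ`-homogeneous: tuples of length less than `κ` with the same type are
conjugate under an automorphism. -/
def IsStronglyHomogeneous (L : FirstOrder.Language.{u, v}) (κ : Cardinal.{w}) (M : Type w)
    [L.Structure M] : Prop :=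
  ∀ I : Type w, Cardinal.mk I < κ → ∀ a b : I → M, tp L a = tp L b →
    ∃ σ : M ≃[L] M, ∀ i, σ (a i) = b i

/-- `M` is a `κ`-monster model of `T`: a nonempty, `κ`-saturated and strongly `κ`-homogeneous
model, where `κ` is larger than `ℵ₀` and than the cardinality of the language. -/
structure IsMonster (T : L.Theory) (κ : Cardinal.{w}) (M : Type w) [L.Structure M] : Prop where
  nonempty : Nonempty M
  model : M ⊨ T
  aleph0_lt : Cardinal.aleph0 < κ
  card_lt : Cardinal.lift.{w} L.card < Cardinal.lift.{max u v} κ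
  saturated : IsSaturated L κ M
  homogeneous : IsStronglyHomogeneous L κ M

/-- A ternary relation on the small subsets of `M` (those of cardinality less than `κ`) is a free
amalgamation relation. `ind A C B` is to be read as "`A` is independent from `B` over `C`". The
values of `ind` at sets that are not small play no role. Tuples are functions whose domain has
cardinality less than `κ`; a tuple is identified with its range where a set is expected. -/
structure IsFreeAmalgamationRelation (L : FirstOrder.Language.{u, v}) (κ : Cardinal.{w}) {M : Type w}
    [L.Structure M] (ind : Set M → Set M → Set M → Prop) : Prop where
  invariance : ∀ A B C : Set M, Cardinal.mk A < κ → Cardinal.mk B < κ → Cardinal.mk C < κ →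
    ∀ σ : M ≃[L] M, ind A C B → ind (σ '' A) (σ '' C) (σ '' B)
  monotonicity : ∀ A B C : Set M, Cardinal.mk A < κ → Cardinal.mk B < κ → Cardinal.mk C < κ →
    ∀ A₀ B₀ : Set M, ind A C B → A₀ ⊆ A → B₀ ⊆ B → ind A₀ C B₀
  symmetry : ∀ A B C : Set M, Cardinal.mk A < κ → Cardinal.mk B < κ → Cardinal.mk C < κ →
    ind A C B → ind B C A
  full_transitivity : ∀ A B C D : Set M, Cardinal.mk A < κ → Cardinal.mk B < κ →
    Cardinal.mk C < κ → Cardinal.mk D < κ → D ⊆ C → C ⊆ B →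
    (ind A D B ↔ ind A C B ∧ ind A D C)
  full_existence : ∀ B C : Set M, Cardinal.mk B < κ → Cardinal.mk C < κ →
    ∀ I : Type w, Cardinal.mk I < κ → ∀ a : I → M, IsClosedSet L C →
    ∃ a' : I → M, EquivOver L C a' a ∧ ind (Set.range a') C B
  stationarity : ∀ C : Set M, Cardinal.mk C < κ → IsClosedSet L C →
    ∀ I J : Type w, Cardinal.mk I < κ → Cardinal.mk J < κ →
    ∀ (a a' : I → M) (b : J → M), IsClosedSet L (Set.range a) → IsClosedSet L (Set.range a') →
    IsClosedSet L (Set.range b) → C ⊆ Set.range a ∩ Set.range b →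
    ind (Set.range a) C (Set.range b) → ind (Set.range a') C (Set.range b) →
    EquivOver L C a' a → EquivOver L C (Sum.elim a b) (Sum.elim a' b)
  freedom : ∀ A B C D : Set M, Cardinal.mk A < κ → Cardinal.mk B < κ → Cardinal.mk C < κ →
    Cardinal.mk D < κ → ind A C B → C ∩ (A ∪ B) ⊆ D → D ⊆ C → ind A D B
  closure : ∀ A B C : Set M, Cardinal.mk A < κ → Cardinal.mk B < κ → Cardinal.mk C < κ →
    IsClosedSet L A → IsClosedSet L B → IsClosedSet L C → C ⊆ A ∩ B → ind A C B →
    IsClosedSet L (A ∪ B)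

end Monster

/-- `T` is a free amalgamation theory: there is a free amalgamation relation on (the small subsets
of) a monster model of `T`. -/
def IsFreeAmalgamationTheory.{u₁, v₁, w₁} {L : FirstOrder.Language.{u₁, v₁}} (T : L.Theory) : Prop :=
  ∃ (κ : Cardinal.{w₁}) (M : Type w₁) (_ : L.Structure M), IsMonster T κ M ∧
    ∃ ind : Set M → Set M → Set M → Prop, IsFreeAmalgamationRelation L κ ind

/-- `T` has the `n`-strong order property (`n ≥ 3`): in a monster model of `T` there is an
indiscernible sequence of tuples of length less than `κ` such that, for `p(x, y) = tp(a_0, a_1)`,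
the set `p(x_1, x_2) ∪ ... ∪ p(x_{n-1}, x_n) ∪ p(x_n, x_1)` is inconsistent. -/
def HasSOP.{u₁, v₁, w₁} {L : FirstOrder.Language.{u₁, v₁}} (T : L.Theory) (n : ℕ) : Prop :=
  ∃ (κ : Cardinal.{w₁}) (M : Type w₁) (_ : L.Structure M), IsMonster T κ M ∧
    ∃ (I : Type w₁) (a : ℕ → I → M), Cardinal.mk I < κ ∧ Indiscernible L a ∧
      ¬ Consistent (cycle (tp L (Sum.elim (a 0) (a 1))) n)

/-- `T` is `NSOP_n`: it does not have the `n`-strong order property. -/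
def IsNSOP.{u₁, v₁, w₁} {L : FirstOrder.Language.{u₁, v₁}} (T : L.Theory) (n : ℕ) : Prop :=
  ¬ HasSOP.{u₁, v₁, w₁} T n

end FreeAmalgamation

/-! By compactness only finite tuples matter, and by completeness an indiscernible sequence of
finite tuples can be copied into the monster model that carries the free amalgamation relation.
Write A_i = acl(a_i). The sets A_1, A_2, A_3 meet pairwise in one closed set C, which lies in A_0.
Full existence gives a conjugate A' of A_3 over A_2, independent from A_1 over A_2; freedom lowers
the base to C, because A_2 meets A_1 ∪ A' only in C. Since A_1 and A' are conjugate over C,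
stationarity yields an automorphism τ interchanging a_1 with the copy a' of a_3 (`exists_swap`).
Then a_1, a_2, a', τ(a_2) is the required cycle: the pairs (a_1, a_2) and (a_2, a') have type p, and
τ maps them to the other two.

The conjugacy over C and the equality of the intersections rest on
`Indiscernible.exists_equiv_fixing_acl`: later terms are conjugate over A_i, not merely over a_i, by
pigeonhole on finite orbits. -/

namespace FreeAmalgamation

open FirstOrder FirstOrder.Language

/-! ### Finite supports of formulas, saturation and homogeneity -/

section Formulas

variable {L : FirstOrder.Language.{u, v}} {M : Type w} [L.Structure M]

/-- The truth of a formula depends only on the values of finitely many variables. -/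
theorem exists_finset_realize_congr {X : Type*} (φ : L.Formula X) :
    ∃ F : Finset X, ∀ (N : Type w) [L.Structure N] (v v' : X → N), (∀ x ∈ F, v x = v' x) →
      (φ.Realize v ↔ φ.Realize v') := by
  classical
  refine ⟨φ.freeVarFinset, fun N _ v v' h => ?_⟩
  have h1 := BoundedFormula.realize_restrictFreeVar (M := N) (φ := φ) (xs := default)
    (f := id) (v := fun x => v x) v (fun _ => rfl)
  have h2 := BoundedFormula.realize_restrictFreeVar (M := N) (φ := φ) (xs := default)
    (f := id) (v := fun x => v x) v' (fun a => h a a.2)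
  exact h1.symm.trans h2

/-- A formula is equivalent to a formula in finitely many of its variables. -/
theorem exists_finset_formula {X : Type*} (φ : L.Formula X) :
    ∃ F : Finset X, ∀ {Y : Type*} (f : F → Y), ∃ ψ : L.Formula Y,
      ∀ (N : Type w) [L.Structure N] (v : Y → N) (v' : X → N), (∀ x : F, v (f x) = v' x) →
      (ψ.Realize v ↔ φ.Realize v') := by
  classical
  refine ⟨φ.freeVarFinset, fun f => ⟨φ.restrictFreeVar f, fun N _ v v' h => ?_⟩⟩
  exact BoundedFormula.realize_restrictFreeVar v' h

theorem definable₁_iff {A : Set M} {S : Set M} :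
    A.Definable₁ L S ↔ ∃ φ : L.Formula (A ⊕ Fin 1),
      ∀ x, x ∈ S ↔ φ.Realize (Sum.elim (↑) fun _ => x) := by
  rw [Set.Definable₁, Set.definable_iff_exists_formula_sum]
  refine exists_congr fun φ => ⟨fun h x => ?_, fun h => ?_⟩
  · exact Set.ext_iff.1 h (fun _ => x)
  · ext y
    have : y = fun _ => y 0 := by
      funext i
      rw [Subsingleton.elim i 0]
    rw [this]
    exact h (y 0)

theorem definable₁_setOf_realize {A : Set M} {X : Type*} (φ : L.Formula (Option X)) (b : X → M)
    (hb : ∀ i, b i ∈ A) : A.Definable₁ L {z | φ.Realize fun o => o.elim z b} := by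
  refine definable₁_iff.2
    ⟨φ.relabel fun o => o.elim (Sum.inr 0) fun i => Sum.inl ⟨b i, hb i⟩, fun x => ?_⟩
  rw [Formula.realize_relabel, Set.mem_ofPred_eq]
  refine iff_of_eq (congrArg φ.Realize ?_)
  funext o
  cases o <;> rfl

/-- A definable set is preserved by the automorphisms fixing a suitable finite set of
parameters. -/
theorem exists_finset_image_eq {A S : Set M} (h : A.Definable₁ L S) :
    ∃ F : Finset M, ↑F ⊆ A ∧ ∀ σ : M ≃[L] M, (∀ b ∈ F, σ b = b) → ∀ x, σ x ∈ S ↔ x ∈ S := by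
  classical
  obtain ⟨φ, hφ⟩ := definable₁_iff.1 h
  obtain ⟨G, hG⟩ := exists_finset_realize_congr φ
  refine ⟨G.biUnion fun i => Sum.elim (fun a : A => {(a : M)}) (fun _ => ∅) i, ?_, ?_⟩
  · intro x hx
    simp only [Finset.coe_biUnion, Set.mem_iUnion] at hx
    obtain ⟨i, hi, hx⟩ := hx
    rcases i with a | i
    · simp only [Sum.elim_inl, Finset.coe_singleton, Set.mem_singleton_iff] at hx
      exact hx ▸ a.2
    · simp at hx
  · intro σ hσ x
    rw [hφ, hφ, ← StrongHomClass.realize_formula σ φ (v := Sum.elim (↑) fun _ => x)]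
    refine hG M _ _ fun i hi => ?_
    rcases i with a | i
    · exact (hσ a (Finset.mem_biUnion.2 ⟨Sum.inl a, hi, by simp⟩)).symm
    · rfl

/-- Types become families of definable sets, so that later saturation arguments need no bookkeeping
of formulas. -/
theorem IsSaturated.exists_forall_mem {κ : Cardinal.{w}} (hM : IsSaturated L κ M) {A : Set M}
    (hA : Cardinal.mk A < κ) (F : Set (Set M)) (hF : ∀ S ∈ F, A.Definable₁ L S)
    (hfin : ∀ F₀ ⊆ F, F₀.Finite → ∃ x, ∀ S ∈ F₀, x ∈ S) : ∃ x, ∀ S ∈ F, x ∈ S := by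
  obtain ⟨x, hx⟩ := hM A hA {φ | {x | φ.Realize fun _ => x} ∈ F} fun Γ hΓ hΓf => by
    obtain ⟨x, hx⟩ := hfin ((fun φ : L[[A]].Formula Unit => {x | φ.Realize fun _ => x}) '' Γ)
      (by rintro _ ⟨φ, hφ, rfl⟩; exact hΓ hφ) (hΓf.image _)
    exact ⟨x, fun φ hφ => hx _ ⟨φ, hφ, rfl⟩⟩
  refine ⟨x, fun S hS => ?_⟩
  obtain ⟨φ, hφ⟩ := hF S hS
  have key : ∀ y, (φ.relabel (fun _ => ())).Realize (fun _ : Unit => y) ↔ y ∈ S := fun y => by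
    rw [Formula.realize_relabel]
    exact (Set.ext_iff.1 hφ fun _ => y).symm
  refine (key x).1 (hx _ ?_)
  have : {y | (φ.relabel (fun _ => ())).Realize (fun _ : Unit => y)} = S := Set.ext key
  exact (congrArg (· ∈ F) this).mpr hS

/-- A formula mentions finitely many variables, so equality of types can be checked on finite
subtuples, each with its own automorphism. -/
theorem IsStronglyHomogeneous.exists_equiv_of_finite {κ : Cardinal.{w}}
    (hM : IsStronglyHomogeneous L κ M) {I : Type w} (hI : Cardinal.mk I < κ) (a b : I → M)
    (h : ∀ F : Finset I, ∃ σ : M ≃[L] M, ∀ i ∈ F, σ (a i) = b i) :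
    ∃ σ : M ≃[L] M, ∀ i, σ (a i) = b i := by
  refine hM I hI a b (Set.ext fun φ => ?_)
  obtain ⟨F, hF⟩ := exists_finset_realize_congr φ
  obtain ⟨σ, hσ⟩ := h F
  exact (StrongHomClass.realize_formula σ φ).symm.trans (hF M _ _ hσ)

end Formulas

/-! ### Algebraic closure and finite orbits -/

section Acl

variable {L : FirstOrder.Language.{u, v}} {M : Type w} [L.Structure M]

theorem acl_mono {A B : Set M} (h : A ⊆ B) : acl L A ⊆ acl L B :=
  fun _ ⟨S, hS, hf, hx⟩ => ⟨S, hS.mono h, hf, hx⟩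

theorem subset_acl (A : Set M) : A ⊆ acl L A := by
  refine fun x hx => ⟨{x}, ?_, Set.finite_singleton x, rfl⟩
  refine definable₁_iff.2
    ⟨Term.equal (Term.var (Sum.inr 0)) (Term.var (Sum.inl ⟨x, hx⟩)), fun y => ?_⟩
  simp [Formula.realize_equal]

variable (L) in
/-- The orbit of `x` under the automorphisms fixing `A` pointwise. -/
def orbitOver (A : Set M) (x : M) : Set M :=
  {y | ∃ σ : M ≃[L] M, (∀ a ∈ A, σ a = a) ∧ σ x = y}

theorem mem_orbitOver_self (A : Set M) (x : M) : x ∈ orbitOver L A x :=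
  ⟨Language.Equiv.refl L M, fun _ _ => rfl, rfl⟩

theorem fixes_symm {A : Set M} {σ : M ≃[L] M} (h : ∀ a ∈ A, σ a = a) : ∀ a ∈ A, σ.symm a = a :=
  fun a ha => (σ.toEquiv.symm_apply_eq).2 (h a ha).symm

theorem apply_mem_orbitOver {A : Set M} {x y : M} {σ : M ≃[L] M} (h : ∀ a ∈ A, σ a = a)
    (hy : y ∈ orbitOver L A x) : σ y ∈ orbitOver L A x := by
  obtain ⟨τ, hτ, rfl⟩ := hy
  exact ⟨σ.comp τ, fun a ha => by rw [Language.Equiv.comp_apply, hτ a ha, h a ha], rfl⟩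

theorem finite_orbitOver_of_mem_acl {A : Set M} {x : M} (h : x ∈ acl L A) :
    (orbitOver L A x).Finite := by
  obtain ⟨S, hS, hf, hx⟩ := h
  obtain ⟨F, hFA, hF⟩ := exists_finset_image_eq hS
  refine hf.subset ?_
  rintro _ ⟨σ, hσ, rfl⟩
  exact (hF σ (fun b hb => hσ b (hFA hb)) x).2 hx

variable {T : L.Theory} {κ : Cardinal.{w}}

theorem IsMonster.mk_lt_of_finite (hM : IsMonster T κ M) (X : Type w) [Finite X] :
    Cardinal.mk X < κ :=
  (Cardinal.lt_aleph0_of_finite X).trans hM.aleph0_lt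

theorem IsMonster.mk_union_lt (hM : IsMonster T κ M) {A B : Set M} (hA : Cardinal.mk A < κ)
    (hB : Cardinal.mk B < κ) : Cardinal.mk ↥(A ∪ B) < κ :=
  (Cardinal.mk_union_le A B).trans_lt (Cardinal.add_lt_of_lt hM.aleph0_lt.le hA hB)

theorem definable₁_compl {A S : Set M} (h : A.Definable₁ L S) : A.Definable₁ L Sᶜ :=
  Set.Definable.compl h

theorem definable₁_inter {A S S' : Set M} (h : A.Definable₁ L S) (h' : A.Definable₁ L S') :
    A.Definable₁ L (S ∩ S') :=
  Set.Definable.inter h h'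

theorem definable₁_sInter {A : Set M} {F : Set (Set M)} (hfin : F.Finite)
    (hF : ∀ S ∈ F, A.Definable₁ L S) : A.Definable₁ L (⋂₀ F) := by
  induction F, hfin using Set.Finite.induction_on with
  | empty =>
    rw [Set.sInter_empty]
    exact Set.definable_univ
  | insert _ _ ih =>
    rw [Set.sInter_insert]
    exact definable₁_inter (hF _ (Set.mem_insert _ _)) (ih fun S hS => hF S (Set.mem_insert_of_mem _ hS))

theorem definable₁_of_finite {A S : Set M} (hfin : S.Finite) (h : S ⊆ A) : A.Definable₁ L S := by
  induction S, hfin using Set.Finite.induction_on with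
  | empty => exact Set.definable_empty
  | @insert x S _ _ ih =>
    have hx : A.Definable₁ L {x} := by
      refine definable₁_iff.2 ⟨Term.equal (Term.var (Sum.inr 0))
        (Term.var (Sum.inl ⟨x, h (Set.mem_insert _ _)⟩)), fun y => ?_⟩
      simp [Formula.realize_equal]
    exact Set.Definable.union hx (ih ((Set.subset_insert _ _).trans h))

/-- In a monster model, `x` is algebraic over a small set `A` if its orbit over `A` is finite. -/
theorem IsMonster.mem_acl_of_finite_orbitOver (hM : IsMonster T κ M) {A : Set M}
    (hA : Cardinal.mk A < κ) {x : M} (h : (orbitOver L A x).Finite) : x ∈ acl L A := by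
  by_contra hx
  have hinf : ∀ S, A.Definable₁ L S → x ∈ S → S.Infinite := fun S hS hxS hSf =>
    hx ⟨S, hS, hSf, hxS⟩
  set O := orbitOver L A x with hO
  have hOκ : Cardinal.mk O < κ :=
    have : Finite O := h
    hM.mk_lt_of_finite O
  -- Every `A`-definable set containing `x` is infinite, hence has points outside the finite orbit
  -- `O`. Saturation gives `y` outside `O` with the type of `x` over `A`; homogeneity then forces
  -- `y` into `O`. The points of `O` are added as parameters to make its complement definable.
  obtain ⟨y, hy⟩ := hM.saturated.exists_forall_mem (hM.mk_union_lt hA hOκ)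
    {S | ∃ S', A.Definable₁ L S' ∧ x ∈ S' ∧ S = S' ∩ Oᶜ}
    (by
      rintro _ ⟨S', hS', -, rfl⟩
      exact definable₁_inter (hS'.mono Set.subset_union_left)
        (definable₁_compl (definable₁_of_finite h Set.subset_union_right)))
    (by
      intro F₀ hF₀ hfin
      choose! g hg hxg hgF using hF₀
      obtain ⟨y, hy, hyO⟩ := ((hinf (⋂₀ (g '' F₀))
        (definable₁_sInter (hfin.image g) (by rintro _ ⟨S, hS, rfl⟩; exact hg hS))
        (by rintro _ ⟨S, hS, rfl⟩; exact hxg hS)).sdiff h).nonempty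
      exact ⟨y, fun S hS => (hgF hS).symm ▸ ⟨hy _ ⟨S, hS, rfl⟩, hyO⟩⟩)
  have hyS : ∀ S, A.Definable₁ L S → x ∈ S → y ∈ S := fun S hS hxS =>
    (hy _ ⟨S, hS, hxS, rfl⟩).1
  have hyO : y ∉ O := (hy _ ⟨Set.univ, Set.definable_univ, trivial, rfl⟩).2
  obtain ⟨σ, hσ⟩ := hM.homogeneous (Option A)
    (by
      rw [Cardinal.mk_option]
      exact Cardinal.add_lt_of_lt hM.aleph0_lt.le hA (Cardinal.one_lt_aleph0.trans hM.aleph0_lt))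
    (fun o => o.elim x (↑)) (fun o => o.elim y (↑)) (Set.ext fun φ => by
      have hd := definable₁_setOf_realize (A := A) φ (fun i : A => (i : M)) fun i => i.2
      constructor
      · exact fun h => hyS _ hd h
      · intro h
        by_contra hn
        exact hyS _ (definable₁_compl hd) hn h)
  exact hyO ⟨σ, fun a ha => hσ (some ⟨a, ha⟩), hσ none⟩

/-- Send each algebraic element to a formula witnessing it: the fibres are finite, and there are
fewer than `κ` formulas over `A`. -/
theorem IsMonster.mk_acl_lt (hM : IsMonster T κ M) {A : Set M} (hA : Cardinal.mk A < κ) :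
    Cardinal.mk (acl L A) < κ := by
  have h : ∀ x : acl L A, ∃ φ : L.Formula (A ⊕ Fin 1),
      {y : M | φ.Realize (Sum.elim (↑) fun _ => y)}.Finite ∧
      φ.Realize (Sum.elim (↑) fun _ => (x : M)) := by
    rintro ⟨x, S, hS, hf, hx⟩
    obtain ⟨φ, hφ⟩ := definable₁_iff.1 hS
    exact ⟨φ, hf.subset fun y hy => (hφ y).2 hy, (hφ x).1 hx⟩
  choose f hf hfx using h
  have hcard : Cardinal.mk (L.Formula (A ⊕ Fin 1)) < Cardinal.lift.{max u v} κ := by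
    have h1 : Cardinal.mk (L.Formula (A ⊕ Fin 1)) ≤
        Cardinal.mk (Σ n, L.BoundedFormula (A ⊕ Fin 1) n) :=
      Cardinal.mk_le_of_injective (f := fun φ => ⟨0, φ⟩) fun φ ψ h => by simpa using h
    refine (h1.trans BoundedFormula.card_le).trans_lt ?_
    have h0 : Cardinal.aleph0 < Cardinal.lift.{max u v} κ := by
      rw [← Cardinal.lift_aleph0.{max u v, w}, Cardinal.lift_lt]
      exact hM.aleph0_lt
    refine max_lt h0 (Cardinal.add_lt_of_lt h0.le ?_ hM.card_lt)
    rw [Cardinal.lift_lt, Cardinal.mk_sum]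
    refine Cardinal.add_lt_of_lt hM.aleph0_lt.le (by simpa using hA) ?_
    refine lt_of_le_of_lt ?_ hM.aleph0_lt
    simp
  have h2 := Cardinal.lift_mk_le_lift_mk_mul_of_lift_mk_preimage_le (c := Cardinal.aleph0.{max u v w}) f fun φ => by
    rw [Cardinal.lift_le_aleph0]
    refine Set.Countable.le_aleph0 ?_
    rcases (f ⁻¹' {φ}).eq_empty_or_nonempty with he | ⟨x, hx⟩
    · rw [he]
      exact Set.countable_empty
    · refine (Set.Finite.preimage Subtype.val_injective.injOn (hf x)).countable.mono fun y hy => ?_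
      rw [Set.mem_preimage, Set.mem_singleton_iff] at hx hy
      rw [hx, ← hy]
      exact hfx y
  rw [← Cardinal.lift_lt.{w, max u v w}]
  have h3 : Cardinal.lift.{w} (Cardinal.mk (L.Formula (A ⊕ Fin 1))) <
      Cardinal.lift.{max u v w} κ := by
    have := Cardinal.lift_lt.{max u v w, w}.2 hcard
    rwa [Cardinal.lift_lift] at this
  have h0 : Cardinal.aleph0 < Cardinal.lift.{max u v w} κ := by
    rw [← Cardinal.lift_aleph0.{max u v w, w}, Cardinal.lift_lt]
    exact hM.aleph0_lt
  exact lt_of_le_of_lt h2 (Cardinal.mul_lt_of_lt h0.le h3 h0)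

end Acl

/-! ### Closed sets and automorphisms -/

section AclClosure

variable {L : FirstOrder.Language.{u, v}} {M : Type w} [L.Structure M] {T : L.Theory}
  {κ : Cardinal.{w}}

/-- If the points of a finite set `F` have finite orbits over `A`, then the automorphisms fixing
`A` have only finitely many restrictions to `F`. -/
theorem finite_restrictions {A F : Set M} (hF : F.Finite)
    (h : ∀ x ∈ F, (orbitOver L A x).Finite) :
    {g : F → M | ∃ σ : M ≃[L] M, (∀ a ∈ A, σ a = a) ∧ ∀ x : F, σ x = g x}.Finite := by
  have : Finite F := hF
  refine (Set.Finite.pi' fun x : F => h x x.2).subset ?_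
  rintro g ⟨σ, hσ, hg⟩ x
  exact ⟨σ, hσ, hg x⟩

/-- If `S` is definable over a finite `F ⊆ acl L A`, its image under an automorphism depends only on
the restriction to `F`. Automorphisms fixing `A` have finitely many such restrictions, so a point of
a finite `S` has finite orbit over `A`. -/
theorem IsMonster.acl_acl (hM : IsMonster T κ M) {A : Set M} (hA : Cardinal.mk A < κ) :
    acl L (acl L A) = acl L A := by
  refine Set.Subset.antisymm (fun x hx => ?_) (subset_acl _)
  obtain ⟨S, hS, hf, hxS⟩ := hx
  obtain ⟨F, hFA, hF⟩ := exists_finset_image_eq hS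
  refine hM.mem_acl_of_finite_orbitOver hA ?_
  have hR := finite_restrictions F.finite_toSet fun y hy =>
    finite_orbitOver_of_mem_acl (L := L) (hFA hy)
  set R := {g : ↥(F : Set M) → M | ∃ σ : M ≃[L] M, (∀ a ∈ A, σ a = a) ∧
    ∀ x : (F : Set M), σ x = g x} with hRdef
  have : ∀ g ∈ R, ∃ σ : M ≃[L] M, ∀ x : (F : Set M), σ x = g x := fun g ⟨σ, _, h⟩ => ⟨σ, h⟩
  choose! s hs using this
  refine (hR.biUnion (t := fun g => s g '' S) fun g _ => hf.image _).subset ?_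
  rintro _ ⟨σ, hσ, rfl⟩
  have hg : (fun x : (F : Set M) => σ x) ∈ R := ⟨σ, hσ, fun _ => rfl⟩
  refine Set.mem_biUnion hg ⟨(s fun x : (F : Set M) => σ x).symm (σ x), ?_, ?_⟩
  · refine (hF ((s fun x : (F : Set M) => σ x).symm.comp σ) (fun b hb => ?_) x).2 hxS
    rw [Language.Equiv.comp_apply]
    exact (Equiv.symm_apply_eq _).2 (hs _ hg ⟨b, hb⟩).symm
  · exact Language.Equiv.apply_symm_apply _ _

theorem IsMonster.isClosedSet_acl (hM : IsMonster T κ M) {A : Set M} (hA : Cardinal.mk A < κ) :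
    IsClosedSet L (acl L A) :=
  hM.acl_acl hA

theorem IsClosedSet.inter {A B : Set M} (hA : IsClosedSet L A) (hB : IsClosedSet L B) :
    IsClosedSet L (A ∩ B) := by
  refine Set.Subset.antisymm (Set.subset_inter ?_ ?_) (subset_acl _)
  · exact (acl_mono Set.inter_subset_left).trans hA.subset
  · exact (acl_mono Set.inter_subset_right).trans hB.subset

theorem orbitOver_image_subset (σ : M ≃[L] M) (A : Set M) (x : M) :
    orbitOver L (σ '' A) (σ x) ⊆ σ '' orbitOver L A x := by
  rintro _ ⟨τ, hτ, rfl⟩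
  refine ⟨σ.symm (τ (σ x)), ⟨(σ.symm.comp τ).comp σ, fun a ha => ?_, rfl⟩,
    Language.Equiv.apply_symm_apply _ _⟩
  rw [Language.Equiv.comp_apply, Language.Equiv.comp_apply, hτ _ ⟨a, ha, rfl⟩,
    Language.Equiv.symm_apply_apply]

theorem mk_image_equiv (σ : M ≃[L] M) (A : Set M) : Cardinal.mk ↥(σ '' A) = Cardinal.mk A :=
  Cardinal.mk_image_eq σ.injective

theorem symm_image_image (σ : M ≃[L] M) (A : Set M) : σ.symm '' (σ '' A) = A := by
  rw [← Set.image_comp]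
  convert Set.image_id A
  exact Language.Equiv.symm_apply_apply _ _

theorem IsMonster.image_acl_subset (hM : IsMonster T κ M) {A : Set M} (hA : Cardinal.mk A < κ)
    (σ : M ≃[L] M) : σ '' acl L A ⊆ acl L (σ '' A) := by
  rintro _ ⟨x, hx, rfl⟩
  refine hM.mem_acl_of_finite_orbitOver ((mk_image_equiv σ A).trans_lt hA) ?_
  exact ((finite_orbitOver_of_mem_acl hx).image σ).subset (orbitOver_image_subset σ A x)

theorem IsMonster.image_acl (hM : IsMonster T κ M) {A : Set M} (hA : Cardinal.mk A < κ)
    (σ : M ≃[L] M) : σ '' acl L A = acl L (σ '' A) := by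
  refine Set.Subset.antisymm (hM.image_acl_subset hA σ) fun x hx => ?_
  have := hM.image_acl_subset ((mk_image_equiv σ A).trans_lt hA) σ.symm ⟨x, hx, rfl⟩
  rw [symm_image_image] at this
  exact ⟨_, this, Language.Equiv.apply_symm_apply _ _⟩

theorem IsMonster.isClosedSet_image (hM : IsMonster T κ M) {A : Set M} (hA : Cardinal.mk A < κ)
    (h : IsClosedSet L A) (σ : M ≃[L] M) : IsClosedSet L (σ '' A) := by
  rw [IsClosedSet, ← hM.image_acl hA, h]

end AclClosure

/-! ### Algebraic closures along an indiscernible sequence -/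

section Indiscernible

variable {L : FirstOrder.Language.{u, v}} {M : Type w} [L.Structure M] {T : L.Theory}
  {κ : Cardinal.{w}} {J : Type w} {a : ℕ → J → M}

variable (L) in
/-- The algebraic closures of the terms of a sequence of tuples. -/
def aclTerm (a : ℕ → J → M) (i : ℕ) : Set M :=
  acl L (Set.range (a i))

theorem Indiscernible.shift (ha : Indiscernible L a) (d : ℕ) :
    Indiscernible L fun n => a (d + n) :=
  fun n s t hs ht φ => ha n (fun k => d + s k) (fun k => d + t k)
    (fun _ _ h => Nat.add_lt_add_left (hs h) d) (fun _ _ h => Nat.add_lt_add_left (ht h) d) φ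

theorem forall_mem_range_fixed {σ : M ≃[L] M} {i : ℕ} (h : ∀ x, σ (a i x) = a i x) :
    ∀ y ∈ Set.range (a i), σ y = y := by
  rintro _ ⟨x, rfl⟩
  exact h x

variable [Finite J]

theorem IsMonster.mk_range_lt (hM : IsMonster T κ M) (b : J → M) :
    Cardinal.mk (Set.range b) < κ :=
  hM.mk_lt_of_finite _

theorem IsMonster.image_aclTerm (hM : IsMonster T κ M) {i j : ℕ} {σ : M ≃[L] M}
    (h : ∀ x, σ (a i x) = a j x) : σ '' aclTerm L a i = aclTerm L a j := by
  rw [aclTerm, hM.image_acl (hM.mk_range_lt _), aclTerm, ← Set.range_comp]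
  exact congrArg (fun f => acl L (Set.range f)) (funext h)

theorem Indiscernible.exists_equiv (ha : Indiscernible L a) (hM : IsMonster T κ M) {n : ℕ}
    {s t : Fin n → ℕ} (hs : StrictMono s) (ht : StrictMono t) :
    ∃ σ : M ≃[L] M, ∀ k x, σ (a (s k) x) = a (t k) x := by
  obtain ⟨σ, hσ⟩ := hM.homogeneous (Fin n × J) (hM.mk_lt_of_finite _)
    (fun k => a (s k.1) k.2) (fun k => a (t k.1) k.2) (Set.ext fun φ => ha n s t hs ht φ)
  exact ⟨σ, fun k x => hσ (k, x)⟩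

theorem strictMono_pair {i j : ℕ} (h : i < j) : StrictMono ![i, j] := by
  intro x y hxy
  fin_cases x <;> fin_cases y <;> simp_all

theorem strictMono_triple {i j k : ℕ} (h : i < j) (h' : j < k) : StrictMono ![i, j, k] := by
  intro x y hxy
  fin_cases x <;> fin_cases y <;> simp_all; omega

theorem Indiscernible.exists_equiv_pair (ha : Indiscernible L a) (hM : IsMonster T κ M)
    {i j i' j' : ℕ} (h : i < j) (h' : i' < j') :
    ∃ σ : M ≃[L] M, (∀ x, σ (a i x) = a i' x) ∧ ∀ x, σ (a j x) = a j' x := by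
  obtain ⟨σ, hσ⟩ := ha.exists_equiv hM (strictMono_pair h) (strictMono_pair h')
  exact ⟨σ, hσ 0, hσ 1⟩

theorem Indiscernible.exists_equiv_triple (ha : Indiscernible L a) (hM : IsMonster T κ M)
    {i j k i' j' k' : ℕ} (h : i < j) (h₁ : j < k) (h' : i' < j') (h₁' : j' < k') :
    ∃ σ : M ≃[L] M, (∀ x, σ (a i x) = a i' x) ∧ (∀ x, σ (a j x) = a j' x) ∧
      ∀ x, σ (a k x) = a k' x := by
  obtain ⟨σ, hσ⟩ := ha.exists_equiv hM (strictMono_triple h h₁) (strictMono_triple h' h₁')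
  exact ⟨σ, hσ 0, hσ 1, hσ 2⟩

/-- Over finitely many points algebraic over the first term, all later terms of an indiscernible
sequence are conjugate. -/
theorem Indiscernible.exists_equiv_fixing_finset (ha : Indiscernible L a) (hM : IsMonster T κ M)
    {F : Set M} (hF : F.Finite) (hFa : F ⊆ aclTerm L a 0) {j k : ℕ} (hj : 0 < j) (hjk : j < k) :
    ∃ σ : M ≃[L] M, (∀ y ∈ F, σ y = y) ∧ ∀ x, σ (a j x) = a k x := by
  -- Unlike `F`, the finite set `O` is preserved by every automorphism fixing `a 0`.
  set O : Set M := ⋃ x ∈ F, orbitOver L (Set.range (a 0)) x with hO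
  have hOfin : O.Finite := hF.biUnion fun x hx => finite_orbitOver_of_mem_acl (hFa hx)
  have hFO : F ⊆ O := fun x hx => Set.mem_biUnion hx (mem_orbitOver_self _ x)
  have hOinv : ∀ σ : M ≃[L] M, (∀ x, σ (a 0 x) = a 0 x) → ∀ y ∈ O, σ y ∈ O := by
    intro σ hσ y hy
    obtain ⟨x, hx, hy⟩ := Set.mem_iUnion₂.1 hy
    exact Set.mem_biUnion hx (apply_mem_orbitOver (forall_mem_range_fixed hσ) hy)
  have hs : ∀ n : ℕ, ∃ σ : M ≃[L] M, (∀ x, σ (a 0 x) = a 0 x) ∧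
      ∀ x, σ (a 1 x) = a (n + 1) x := fun n =>
    ha.exists_equiv_pair hM Nat.zero_lt_one n.succ_pos
  choose s hs0 hs1 using hs
  have hs0' : ∀ n x, (s n).symm (a 0 x) = a 0 x := fun n x =>
    (Equiv.symm_apply_eq (s n).toEquiv).2 (hs0 n x).symm
  have : Finite O := hOfin
  -- Pigeonhole: two of the inverses agree on `O`, so `s n` composed with the inverse of `s m` fixes
  -- `O` pointwise and takes `a (m + 1)` to `a (n + 1)`.
  obtain ⟨m, n, hmn, hres⟩ := Finite.exists_ne_map_eq_of_infinite
    fun n => fun y : O => (⟨(s n).symm y, hOinv _ (hs0' n) y y.2⟩ : O)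
  wlog hlt : m < n generalizing m n
  · exact this n m hmn.symm hres.symm (lt_of_le_of_ne (not_lt.1 hlt) hmn.symm)
  have hres' : ∀ y ∈ O, (s m).symm y = (s n).symm y := fun y hy =>
    congrArg Subtype.val (congrFun hres ⟨y, hy⟩)
  -- Conjugating by `τ`, which preserves `O`, replaces the indices `m + 1, n + 1` by `j, k`.
  obtain ⟨τ, hτ0, hτ1, hτ2⟩ := ha.exists_equiv_triple hM (Nat.succ_pos m)
    (Nat.succ_lt_succ hlt) hj hjk
  have hτ : ∀ i i' : ℕ, (∀ x, τ (a i x) = a i' x) → ∀ x, τ.symm (a i' x) = a i x :=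
    fun i i' h x => (Equiv.symm_apply_eq τ.toEquiv).2 (h x).symm
  refine ⟨τ.comp ((s n).comp ((s m).symm.comp τ.symm)), fun y hy => ?_, fun x => ?_⟩
  · simp only [Language.Equiv.comp_apply]
    rw [hres' _ (hOinv _ (hτ 0 0 hτ0) y (hFO hy)), Language.Equiv.apply_symm_apply,
      Language.Equiv.apply_symm_apply]
  · simp only [Language.Equiv.comp_apply]
    rw [hτ _ _ hτ1, ← hs1 m, Language.Equiv.symm_apply_apply, hs1, hτ2]

/-- The later terms of an indiscernible sequence of finite tuples are conjugate over the algebraic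
closure of the first term. -/
theorem Indiscernible.exists_equiv_fixing_acl_zero (ha : Indiscernible L a)
    (hM : IsMonster T κ M) {j k : ℕ} (hj : 0 < j) (hjk : j < k) :
    ∃ σ : M ≃[L] M, (∀ y ∈ aclTerm L a 0, σ y = y) ∧ ∀ x, σ (a j x) = a k x := by
  classical
  obtain ⟨σ, hσ⟩ := hM.homogeneous.exists_equiv_of_finite (I := aclTerm L a 0 ⊕ J)
    (by
      rw [Cardinal.mk_sum, Cardinal.lift_id, Cardinal.lift_id]
      exact Cardinal.add_lt_of_lt hM.aleph0_lt.le (hM.mk_acl_lt (hM.mk_range_lt _))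
        (hM.mk_lt_of_finite J))
    (Sum.elim (↑) (a j)) (Sum.elim (↑) (a k)) (by
      intro F
      obtain ⟨σ, hσ, hσ'⟩ := ha.exists_equiv_fixing_finset hM
        (F := {y | ∃ h : y ∈ aclTerm L a 0, Sum.inl ⟨y, h⟩ ∈ F})
        ((F.finite_toSet.image (Sum.elim (↑) (a 0))).subset
          (by rintro y ⟨h, hy⟩; exact ⟨_, hy, rfl⟩))
        (by rintro y ⟨h, -⟩; exact h) hj hjk
      refine ⟨σ, ?_⟩
      rintro (y | x) hi
      · exact hσ y ⟨y.2, hi⟩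
      · exact hσ' x)
  exact ⟨σ, fun y hy => hσ (Sum.inl ⟨y, hy⟩), fun x => hσ (Sum.inr x)⟩

theorem Indiscernible.exists_equiv_fixing_acl (ha : Indiscernible L a)
    (hM : IsMonster T κ M) {i j k : ℕ} (hj : i < j) (hjk : j < k) :
    ∃ σ : M ≃[L] M, (∀ y ∈ aclTerm L a i, σ y = y) ∧ ∀ x, σ (a j x) = a k x := by
  obtain ⟨σ, h, h'⟩ := (ha.shift i).exists_equiv_fixing_acl_zero hM (j := j - i) (k := k - i)
    (by omega) (by omega)
  refine ⟨σ, h, fun x => ?_⟩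
  have := h' x
  rwa [Nat.add_sub_cancel' hj.le, Nat.add_sub_cancel' (hj.trans hjk).le] at this

/-- An automorphism fixing the closure of `a i` pointwise carries the closure of `a j` to that of `a
k`, so both have the same trace on the former. -/
theorem Indiscernible.aclTerm_inter_eq (ha : Indiscernible L a) (hM : IsMonster T κ M)
    {i j k : ℕ} (hj : i < j) (hjk : j < k) :
    aclTerm L a i ∩ aclTerm L a j = aclTerm L a i ∩ aclTerm L a k := by
  obtain ⟨σ, h, h'⟩ := ha.exists_equiv_fixing_acl hM hj hjk
  ext y
  refine and_congr_right fun hy => ?_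
  rw [← hM.image_aclTerm h']
  constructor
  · exact fun hy' => ⟨y, hy', h y hy⟩
  · rintro ⟨z, hz, hzy⟩
    rwa [← σ.injective (hzy.trans (h y hy).symm)]

/-- A counting argument on the finite orbit `O` over `a k` of a point `y` of the intersection. By
`aclTerm_inter_eq`, the trace on `O` of the closure of `a i` lies in that of `a j`; an automorphism
fixing `a k` and taking `a j` to `a i` shows that it is no smaller. The traces are equal, and `y`
lies in the second. -/
theorem Indiscernible.aclTerm_inter_subset (ha : Indiscernible L a) (hM : IsMonster T κ M)
    {i j k : ℕ} (hj : i < j) (hjk : j < k) :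
    aclTerm L a j ∩ aclTerm L a k ⊆ aclTerm L a i := by
  rintro y ⟨hyj, hyk⟩
  have hO : (orbitOver L (Set.range (a k)) y).Finite := finite_orbitOver_of_mem_acl hyk
  set O := orbitOver L (Set.range (a k)) y with hOdef
  have hOk : O ⊆ aclTerm L a k := by
    rintro _ ⟨σ, hσ, rfl⟩
    rw [← hM.image_aclTerm (i := k) (j := k) (σ := σ) fun x => hσ _ ⟨x, rfl⟩]
    exact ⟨y, hyk, rfl⟩
  have hsub : O ∩ aclTerm L a i ⊆ O ∩ aclTerm L a j := fun z hz =>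
    ⟨hz.1, ((ha.aclTerm_inter_eq hM hj hjk).superset ⟨hz.2, hOk hz.1⟩).2⟩
  obtain ⟨σ, hσ, hσk⟩ := ha.exists_equiv_pair hM hjk (hj.trans hjk)
  have hcard : (O ∩ aclTerm L a j).ncard ≤ (O ∩ aclTerm L a i).ncard := by
    refine Set.ncard_le_ncard_of_injOn σ (fun z hz => ⟨?_, ?_⟩) σ.injective.injOn
      (hO.subset Set.inter_subset_left)
    · exact apply_mem_orbitOver (forall_mem_range_fixed hσk) hz.1
    · rw [← hM.image_aclTerm hσ]
      exact ⟨z, hz.2, rfl⟩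
  have heq := Set.eq_of_subset_of_ncard_le hsub hcard (hO.subset Set.inter_subset_left)
  exact (heq.superset ⟨mem_orbitOver_self _ y, hyj⟩).2

end Indiscernible

/-! ### The swap and the 4-cycle -/

section Amalgamation

variable {L : FirstOrder.Language.{u, v}} {M : Type w} [L.Structure M] {T : L.Theory}
  {κ : Cardinal.{w}} {ind : Set M → Set M → Set M → Prop}

/-- If `A` is independent over `C` from its image under an automorphism `θ` fixing `C`, then some
automorphism interchanges `A` with this image along `θ`. -/
theorem IsFreeAmalgamationRelation.exists_swap (hind : IsFreeAmalgamationRelation L κ ind)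
    (hM : IsMonster T κ M) {A C : Set M} (hA : Cardinal.mk A < κ) (hAc : IsClosedSet L A)
    (hCc : IsClosedSet L C) (hCA : C ⊆ A) (θ : M ≃[L] M) (hθ : ∀ c ∈ C, θ c = c)
    (h : ind A C (θ '' A)) :
    ∃ τ : M ≃[L] M, (∀ x ∈ A, τ x = θ x) ∧ ∀ x ∈ A, τ (θ x) = x := by
  have hC : Cardinal.mk C < κ := (Cardinal.mk_le_mk_of_subset hCA).trans_lt hA
  have hB : Cardinal.mk ↥(θ '' A) < κ := (mk_image_equiv θ A).trans_lt hA
  have hB' : Cardinal.mk ↥(θ '' (θ '' A)) < κ := (mk_image_equiv θ _).trans_lt hB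
  have hθC : θ '' C = C := by
    ext y
    constructor
    · rintro ⟨x, hx, rfl⟩
      exact (hθ x hx).symm ▸ hx
    · exact fun hy => ⟨y, hy, hθ y hy⟩
  have hCB : C ⊆ θ '' A := hθC.superset.trans (Set.image_mono hCA)
  have h' : ind (θ '' (θ '' A)) C (θ '' A) := by
    have := hind.invariance _ _ _ hB hA hC θ (hind.symmetry _ _ _ hA hB hC h)
    rwa [hθC] at this
  have r1 : Set.range (fun x : A => (x : M)) = A := Subtype.range_coe
  have r2 : Set.range (fun x : A => θ x) = θ '' A := (Set.image_eq_range _ _).symm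
  have r3 : Set.range (fun x : A => θ (θ x)) = θ '' (θ '' A) := by
    rw [← r2, ← Set.range_comp]
    rfl
  -- Stationarity compares `A` with its image under `θ` twice, both independent over `C` from `θ ''
  -- A`. The resulting `τ` sends `x` to `θ (θ x)` and fixes `θ x`, so `τ⁻¹ ∘ θ` is the swap.
  obtain ⟨τ, -, hτ⟩ := hind.stationarity C hC hCc A A hA hA (fun x => (x : M))
    (fun x => θ (θ x)) (fun x => θ x) (r1.symm ▸ hAc)
    (r3.symm ▸ hM.isClosedSet_image hB (hM.isClosedSet_image hA hAc θ) θ)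
    (r2.symm ▸ hM.isClosedSet_image hA hAc θ)
    (by rw [r1, r2]; exact Set.subset_inter hCA hCB)
    (by rw [r1, r2]; exact h) (by rw [r3, r2]; exact h')
    ⟨(θ.comp θ).symm, fixes_symm fun c hc => by
      rw [Language.Equiv.comp_apply, hθ c hc, hθ c hc],
      fun x => Language.Equiv.symm_apply_apply (θ.comp θ) _⟩
  refine ⟨τ.symm.comp θ, fun x hx => ?_, fun x hx => ?_⟩
  · exact (Equiv.symm_apply_eq τ.toEquiv).2 (hτ (Sum.inr ⟨x, hx⟩)).symm
  · exact (Equiv.symm_apply_eq τ.toEquiv).2 (hτ (Sum.inl ⟨x, hx⟩)).symm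

/-- In the presence of a free amalgamation relation, the type of a pair of terms of an indiscernible
sequence of finite tuples can be arranged in a `4`-cycle. -/
theorem IsFreeAmalgamationRelation.exists_four_cycle (hind : IsFreeAmalgamationRelation L κ ind)
    (hM : IsMonster T κ M) {J : Type w} [Finite J] {a : ℕ → J → M} (ha : Indiscernible L a) :
    ∃ b : Fin 4 → J → M, ∀ k : Fin 4, ∃ σ : M ≃[L] M,
      (∀ x, σ (a 0 x) = b k x) ∧ ∀ x, σ (a 1 x) = b (finRotate 4 k) x := by
  have hsmall : ∀ i, Cardinal.mk (aclTerm L a i) < κ := fun i => hM.mk_acl_lt (hM.mk_range_lt _)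
  have hclosed : ∀ i, IsClosedSet L (aclTerm L a i) := fun i =>
    hM.isClosedSet_acl (hM.mk_range_lt _)
  have hmem : ∀ i x, a i x ∈ aclTerm L a i := fun i x => subset_acl _ ⟨x, rfl⟩
  set C := aclTerm L a 1 ∩ aclTerm L a 2 with hC
  have hC0 : C ⊆ aclTerm L a 0 := ha.aclTerm_inter_subset hM (by omega) (by omega)
  have h123 : C = aclTerm L a 1 ∩ aclTerm L a 3 := ha.aclTerm_inter_eq hM (by omega) (by omega)
  have hC23 : aclTerm L a 2 ∩ aclTerm L a 3 = C := by
    refine Set.Subset.antisymm (fun y hy => ?_) fun y hy => ⟨hy.2, (h123.subset hy).2⟩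
    exact ⟨ha.aclTerm_inter_subset hM (by omega) (by omega) hy, hy.1⟩
  have hCc : IsClosedSet L C := (hclosed 1).inter (hclosed 2)
  have hCκ : Cardinal.mk C < κ :=
    (Cardinal.mk_le_mk_of_subset Set.inter_subset_left).trans_lt (hsmall 1)
  -- The term `a 0` is kept in reserve so that `σ`, fixing its closure, fixes `C` while taking `a 1`
  -- to `a 3`.
  obtain ⟨σ, hσ, hσ13⟩ := ha.exists_equiv_fixing_acl hM (i := 0) (j := 1) (k := 3) (by omega)
    (by omega)
  obtain ⟨a', ⟨ρ, hρ, hρa⟩, hinda⟩ := hind.full_existence (aclTerm L a 1) (aclTerm L a 2)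
    (hsmall 1) (hsmall 2) (aclTerm L a 3) (hsmall 3) (fun x => (x : M)) (hclosed 2)
  have hρ' := fixes_symm hρ
  have hrange : Set.range a' = ρ.symm '' aclTerm L a 3 := by
    rw [Set.image_eq_range]
    exact congrArg Set.range (funext fun i =>
      ((Equiv.symm_apply_eq ρ.toEquiv).2 (hρa i).symm).symm)
  set θ : M ≃[L] M := ρ.symm.comp σ with hθ
  have hθC : ∀ c ∈ C, θ c = c := fun c hc => by
    rw [hθ, Language.Equiv.comp_apply, hσ c (hC0 hc), hρ' c hc.2]
  have hθA : θ '' aclTerm L a 1 = Set.range a' := by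
    rw [hrange, ← hM.image_aclTerm hσ13, ← Set.image_comp]
    rfl
  have hBκ : Cardinal.mk (Set.range a') < κ := hθA ▸ (mk_image_equiv θ _).trans_lt (hsmall 1)
  -- As `ρ` fixes the closure of `a 2`, the range of `a'` meets that closure exactly where the
  -- closure of `a 3` does, namely in `C`.
  have hfree : ind (Set.range a') C (aclTerm L a 1) := by
    refine hind.freedom _ _ _ _ hBκ (hsmall 1) (hsmall 2) hCκ hinda ?_ Set.inter_subset_right
    rintro y ⟨hy2, hy | hy⟩
    · rw [hrange] at hy
      obtain ⟨z, hz, rfl⟩ := hy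
      have : z = ρ.symm z := by
        have := hρ _ hy2
        rwa [Language.Equiv.apply_symm_apply] at this
      rw [← this] at hy2 ⊢
      exact hC23.subset ⟨hy2, hz⟩
    · exact ⟨hy, hy2⟩
  obtain ⟨τ, hτ, hτ'⟩ := hind.exists_swap hM (hsmall 1) (hclosed 1) hCc Set.inter_subset_left θ
    hθC (hθA.symm ▸ hind.symmetry _ _ _ hBκ (hsmall 1) hCκ hfree)
  obtain ⟨π, hπ0, hπ1⟩ := ha.exists_equiv_pair hM (i := 0) (j := 1) (i' := 1) (j' := 2)
    (by omega) (by omega)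
  obtain ⟨π', hπ'0, hπ'1⟩ := ha.exists_equiv_pair hM (i := 0) (j := 1) (i' := 2) (j' := 3)
    (by omega) (by omega)
  have hθ1 : ∀ x, θ (a 1 x) = ρ.symm (a 3 x) := fun x => by
    rw [hθ, Language.Equiv.comp_apply, hσ13]
  refine ⟨![a 1, a 2, fun x => θ (a 1 x), fun x => τ (a 2 x)], fun k => ?_⟩
  fin_cases k
  · exact ⟨π, hπ0, hπ1⟩
  · refine ⟨ρ.symm.comp π', fun x => ?_, fun x => ?_⟩
    · exact (congrArg ρ.symm (hπ'0 x)).trans (hρ' _ (hmem 2 x))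
    · exact (congrArg ρ.symm (hπ'1 x)).trans (hθ1 x).symm
  · refine ⟨τ.comp π, fun x => ?_, fun x => ?_⟩
    · exact (congrArg τ (hπ0 x)).trans (hτ _ (hmem 1 x))
    · exact congrArg τ (hπ1 x)
  · refine ⟨τ.comp (ρ.symm.comp π'), fun x => ?_, fun x => ?_⟩
    · exact congrArg τ ((congrArg ρ.symm (hπ'0 x)).trans (hρ' _ (hmem 2 x)))
    · exact (congrArg τ ((congrArg ρ.symm (hπ'1 x)).trans (hθ1 x).symm)).trans
        (hτ' _ (hmem 1 x))

end Amalgamation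

/-! ### Realising types in another model, and consistency -/

section Transfer

variable {L : FirstOrder.Language.{u, v}} {T : L.Theory} {κ : Cardinal.{w}}
  {M N : Type w} [L.Structure M] [L.Structure N]

variable (L) in
/-- Two tuples, possibly in different structures, satisfy the same formulas. -/
def SameType {X : Type*} (b : X → M) (c : X → N) : Prop :=
  ∀ φ : L.Formula X, φ.Realize b ↔ φ.Realize c

theorem SameType.comp {X Y : Type*} {b : X → M} {c : X → N} (h : SameType L b c) (f : Y → X) :
    SameType L (b ∘ f) (c ∘ f) := fun φ => by
  rw [← Formula.realize_relabel, ← Formula.realize_relabel]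
  exact h _

theorem sameType_of_isComplete (hT : T.IsComplete) [M ⊨ T] [N ⊨ T] [Nonempty M] [Nonempty N]
    {X : Type*} [IsEmpty X] (b : X → M) (c : X → N) : SameType L b c := fun φ => by
  have key : ∀ (K : Type w) [L.Structure K] [K ⊨ T] [Nonempty K] (d : X → K),
      φ.Realize d ↔ T ⊨ᵇ (φ.relabel (isEmptyElim : X → Empty) : L.Sentence) := by
    intro K _ _ _ d
    rw [← hT.realize_sentence_iff _ K, Sentence.Realize, Formula.realize_relabel]
    exact iff_of_eq (congrArg φ.Realize (Subsingleton.elim _ _))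
  exact (key M b).trans (key N c).symm

/-- A finite part of the type of `x` over `c` is one formula, whose existential quantification
passes from `c` to `b`; saturation realises the whole type. -/
theorem IsMonster.exists_sameType_option (hM : IsMonster T κ M) {X : Type} [Finite X]
    {b : X → M} {c : X → N} (h : SameType L b c) (x : N) :
    ∃ y : M, SameType L (fun o : Option X => o.elim y b) fun o => o.elim x c := by
  have hreal : ∀ φ : L.Formula (Option X), φ.Realize (fun o => o.elim x c) →
      ∃ y, φ.Realize fun o => o.elim y b := by
    intro φ hφ
    have key : ∀ (K : Type w) [L.Structure K] (d : X → K),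
        ((φ.relabel (fun o => o.elim (Sum.inr ()) Sum.inl : Option X → X ⊕ Unit)).iExs
          Unit).Realize d ↔ ∃ y, φ.Realize fun o => o.elim y d := by
      intro K _ d
      rw [Formula.realize_iExs]
      have : ∀ i : Unit → K, Sum.elim d i ∘
          (fun o => o.elim (Sum.inr ()) Sum.inl : Option X → X ⊕ Unit) =
          fun o => o.elim (i ()) d := fun i => by
        funext o
        cases o <;> rfl
      simp only [Formula.realize_relabel, this]
      exact ⟨fun ⟨i, hi⟩ => ⟨_, hi⟩, fun ⟨y, hy⟩ => ⟨fun _ => y, hy⟩⟩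
    exact (key M b).1 ((h _).2 ((key N c).2 ⟨x, hφ⟩))
  obtain ⟨y, hy⟩ := hM.saturated.exists_forall_mem
    (A := Set.range b) (hM.mk_lt_of_finite _)
    {S | ∃ φ : L.Formula (Option X), φ.Realize (fun o => o.elim x c) ∧
      S = {z | φ.Realize fun o => o.elim z b}}
    (by
      rintro _ ⟨φ, -, rfl⟩
      exact definable₁_setOf_realize φ b fun i => ⟨i, rfl⟩)
    (by
      intro F hF hfin
      have hF' : ∀ S : F, ∃ φ : L.Formula (Option X), φ.Realize (fun o => o.elim x c) ∧
          (S : Set M) = {z | φ.Realize fun o => o.elim z b} := fun S => hF S.2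
      choose φ hφ hφS using hF'
      have : Finite F := hfin
      obtain ⟨y, hy⟩ := hreal (BoundedFormula.iInf φ)
        (BoundedFormula.realize_iInf.2 hφ)
      exact ⟨y, fun S hS => (hφS ⟨S, hS⟩).superset (BoundedFormula.realize_iInf.1 hy ⟨S, hS⟩)⟩)
  refine ⟨y, fun φ => ⟨fun hφ => ?_, fun hφ => hy _ ⟨φ, hφ, rfl⟩⟩⟩
  by_contra hn
  exact (hy _ ⟨φ.not, hn, rfl⟩ : φ.not.Realize fun o : Option X => o.elim y b) hφ

/-- A monster model of a complete theory realises the type of every sequence of elements of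
another model. -/
theorem IsMonster.exists_sameType_nat (hM : IsMonster T κ M) (hT : T.IsComplete) [N ⊨ T]
    [Nonempty N] (c : ℕ → N) : ∃ b : ℕ → M, SameType L b c := by
  have := hM.model
  have := hM.nonempty
  have step : ∀ n (f : Fin n → M), SameType L f (fun i => c i) →
      ∃ y : M, SameType L (Fin.snoc f y : Fin (n + 1) → M) fun i => c i := by
    intro n f hf
    obtain ⟨y, hy⟩ := hM.exists_sameType_option hf (c n)
    refine ⟨y, ?_⟩
    convert hy.comp (Fin.lastCases none some : Fin (n + 1) → Option (Fin n)) using 1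
    · funext i
      refine Fin.lastCases ?_ (fun i => ?_) i <;> simp
    · funext i
      refine Fin.lastCases ?_ (fun i => ?_) i <;> simp
  choose! y hy using step
  let g : ∀ n : ℕ, {f : Fin n → M // SameType L f fun i => c i} := fun n =>
    n.rec ⟨Fin.elim0, sameType_of_isComplete hT _ _⟩
      fun n f => ⟨Fin.snoc f.1 (y n f.1), hy n f.1 f.2⟩
  -- Each stage extends the previous one, so an entry never changes once added.
  have hg : ∀ n (i : Fin n), (g n).1 i = (g (i + 1)).1 (Fin.last i) := by
    intro n
    induction n with
    | zero => exact fun i => i.elim0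
    | succ n ih =>
      intro i
      refine Fin.lastCases rfl (fun i => ?_) i
      exact (Fin.snoc_castSucc (α := fun _ => M) _ _ i).trans (ih i)
  refine ⟨fun n => (g (n + 1)).1 (Fin.last n), fun φ => ?_⟩
  obtain ⟨F, hF⟩ := exists_finset_formula.{u, v, w} φ
  have hlt : ∀ x : F, (x : ℕ) < F.sup id + 1 := fun x =>
    Nat.lt_succ_of_le (Finset.le_sup (f := id) x.2)
  obtain ⟨ψ, hψ⟩ := hF fun x => (⟨x, hlt x⟩ : Fin (F.sup id + 1))
  rw [← hψ N (fun i => c i) c fun _ => rfl, ← hψ M (g _).1 _ fun x => hg _ _]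
  exact (g _).2 ψ

theorem IsMonster.exists_sameType (hM : IsMonster T κ M) (hT : T.IsComplete) [N ⊨ T]
    [Nonempty N] {X : Type*} [Countable X] (c : X → N) : ∃ b : X → M, SameType L b c := by
  obtain ⟨f, hf⟩ := exists_injective_nat X
  obtain ⟨b, hb⟩ := hM.exists_sameType_nat hT
    (Function.extend f c fun _ => Classical.arbitrary N)
  refine ⟨b ∘ f, ?_⟩
  have := hb.comp f
  rwa [Function.extend_comp hf] at this

theorem consistent_of_realize {J : Type w} {Γ : Set (L.Formula J)} [Nonempty M] (v : J → M)
    (h : ∀ φ ∈ Γ, φ.Realize v) : Consistent Γ := by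
  let := constantsOn.structure v
  have : M ⊨ (Formula.equivSentence '' Γ : L[[J]].Theory) := by
    refine (Theory.model_iff _).2 ?_
    rintro _ ⟨φ, hφ, rfl⟩
    exact (Formula.realize_equivSentence M φ).2 (h φ hφ)
  exact Theory.Model.isSatisfiable M

theorem consistent_of_finite {J : Type w} {Γ : Set (L.Formula J)}
    (h : ∀ Γ₀ : Set (L.Formula J), Γ₀ ⊆ Γ → Γ₀.Finite → Consistent Γ₀) : Consistent Γ := by
  refine Theory.isSatisfiable_iff_isFinitelySatisfiable.2 fun T₀ hT₀ => ?_
  refine (h {φ ∈ Γ | Formula.equivSentence φ ∈ T₀} (fun φ hφ => hφ.1)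
    ((T₀.finite_toSet.preimage Formula.equivSentence.injective.injOn).subset
      fun φ hφ => hφ.2)).mono fun ψ hψ => ?_
  obtain ⟨φ, hφ, rfl⟩ := hT₀ hψ
  exact ⟨φ, ⟨hφ, hψ⟩, rfl⟩

end Transfer

/-! ### Reduction to finite tuples and conclusion -/

theorem IsFreeAmalgamationTheory.isNSOP_four {L : FirstOrder.Language.{u, v}} {T : L.Theory}
    (h : IsFreeAmalgamationTheory.{u, v, w} T) (hT : T.IsComplete) :
    IsNSOP.{u, v, w} T 4 := by
  classical
  obtain ⟨κ, M, _, hM, ind, hind⟩ := h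
  -- The monster model `N` of the order property need not be the model `M` carrying the relation.
  rintro ⟨κ', N, _, hN, I, a, -, ha, hcons⟩
  have := hN.model
  have := hN.nonempty
  have := hM.nonempty
  refine hcons (consistent_of_finite fun Γ₀ hΓ hfin => ?_)
  have hcyc : ∀ φ : Γ₀, ∃ (k : Fin 4) (ψ : L.Formula (I ⊕ I)),
      ψ.Realize (Sum.elim (a 0) (a 1)) ∧
      ψ.relabel (Sum.elim (fun i => (k, i)) (fun i => (finRotate 4 k, i))) = φ := by
    intro φ
    obtain ⟨k, ψ, hψ, h⟩ := Set.mem_iUnion.1 (hΓ φ.2)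
    exact ⟨k, ψ, hψ, h⟩
  choose k ψ hψ hφ using hcyc
  choose F hF using fun φ => exists_finset_formula.{u, v, w} (ψ φ)
  have : Fintype Γ₀ := hfin.fintype
  -- The coordinates occurring in either tuple of variables of some `ψ φ`. Restricting to them
  -- leaves a countable family `ℕ × J` to copy into `M`.
  let J : Finset I := Finset.univ.biUnion fun φ => (F φ).image (Sum.elim id id)
  have hJ : ∀ (φ : Γ₀) (x : F φ), Sum.elim id id (x : I ⊕ I) ∈ J := fun φ x =>
    Finset.mem_biUnion.2 ⟨φ, Finset.mem_univ _, Finset.mem_image_of_mem _ x.2⟩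
  obtain ⟨b, hb⟩ := hM.exists_sameType hT fun p : ℕ × J => a p.1 p.2
  have hbi : Indiscernible L fun n (j : J) => b (n, j) := by
    intro n s t hs ht φ
    have e : ∀ r : Fin n → ℕ, φ.Realize (fun p : Fin n × J => b (r p.1, p.2)) ↔
        (φ.relabel fun p : Fin n × J => (p.1, (p.2 : I))).Realize
          fun p => a (r p.1) p.2 := fun r => by
      rw [Formula.realize_relabel]
      exact hb.comp (fun p : Fin n × J => (r p.1, p.2)) φ
    exact (e s).trans ((ha n s t hs ht _).trans (e t).symm)
  obtain ⟨d, hd⟩ := hind.exists_four_cycle hM hbi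
  -- Coordinates outside `J` do not affect the formulas of `Γ₀`, so their value is arbitrary.
  refine consistent_of_realize (M := M)
    (fun p => if h : p.2 ∈ J then d p.1 ⟨p.2, h⟩ else Classical.arbitrary M) fun φ hφΓ => ?_
  obtain ⟨σ, hσ0, hσ1⟩ := hd (k ⟨φ, hφΓ⟩)
  -- `χ` is `ψ` rewritten in the variables from `J`, where the tuples `b` and `d` live.
  obtain ⟨χ, hχ⟩ := hF ⟨φ, hφΓ⟩ fun x =>
    (Sum.map (fun i => ⟨Sum.elim id id (x : I ⊕ I), hJ _ x⟩)
      (fun i => ⟨Sum.elim id id (x : I ⊕ I), hJ _ x⟩) (x : I ⊕ I) : J ⊕ J)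
  have h1 : χ.Realize (Sum.elim (fun j : J => a 0 j) fun j : J => a 1 j) := by
    refine (hχ N _ (Sum.elim (a 0) (a 1)) ?_).2 (hψ _)
    rintro ⟨i | i, hi⟩ <;> rfl
  have h2 : χ.Realize (Sum.elim (fun j : J => b (0, j)) fun j : J => b (1, j)) := by
    have := (hb.comp (Sum.elim (fun j : J => (0, j)) fun j : J => (1, j)) χ)
    rw [Sum.comp_elim, Sum.comp_elim] at this
    exact this.2 h1
  have h3 : χ.Realize (Sum.elim (d (k ⟨φ, hφΓ⟩)) (d (finRotate 4 (k ⟨φ, hφΓ⟩)))) := by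
    rw [← StrongHomClass.realize_formula σ, Sum.comp_elim] at h2
    convert h2 using 2
    · exact funext fun x => (hσ0 x).symm
    · exact funext fun x => (hσ1 x).symm
  have hrel := (hφ ⟨φ, hφΓ⟩).symm
  dsimp only at hrel
  rw [hrel, Formula.realize_relabel]
  refine (hχ M _ _ ?_).1 h3
  rintro ⟨i | i, hi⟩
  · have : i ∈ J := hJ ⟨φ, hφΓ⟩ ⟨Sum.inl i, hi⟩
    simp [this]
  · have : i ∈ J := hJ ⟨φ, hφΓ⟩ ⟨Sum.inr i, hi⟩
    simp [this]

end FreeAmalgamation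

theorem theorem4p4 {L : FirstOrder.Language.{u, v}} (T : L.Theory)
    (hT : T.IsComplete) (h : FreeAmalgamation.IsFreeAmalgamationTheory.{u, v, w} T) :
    FreeAmalgamation.IsNSOP.{u, v, w} T 4 := by
  exact h.isNSOP_four hT
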